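/- Let $d\in\{2,3\}$ and let $\Omega\subset\mathbb R^d$ be a bounded connected open set (e.g. with polygonal or Lipschitz polyhedral boundary) having a conforming simplicial triangulation $\mathcal T_h$: a finite simplicial complex all of whose faces are faces of its $d$-simplices and whose union is $\overline\Omega$. Let $\nu>0$, $\lambda>0$, let $k\ge 1$ be an integer and let $\mathbf f\in \mathbf H^{-1}(\Omega)$, the dual of $\mathbf H^1_0(\Omega):=H^1_0(\Omega)^d$. Write $L^2_{zmv}(\Omega)$ for the functions in $L^2(\Omega)$ with zero mean value, $(\mathbf v,\mathbf w)_{\mathbf H^1_0(\Omega)}=\sum_{i,j}(\partial_jv_i,\partial_jw_i)_{L^2(\Omega)}$ with associated norm $\|\cdot\|_{\mathbf H^1_0(\Omega)}$, and, for $\mu>0$, $\|(\mathbf v,q)\|_{\mathcal X,\mu}=\big(\|\mathbf v\|_{\mathbf H^1_0(\Omega)}^2+\mu^{-2}\|q\|_{L^2(\Omega)}^2\big)^{1/2}$. Let $(\mathbf u,p)\in\mathbf H^1_0(\Omega)\times L^2_{zmv}(\Omega)$ be the weak solution of the incompressible Stokes problem $$\nu(\mathbf u,\mathbf v)_{\mathbf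 H^1_0(\Omega)}-(p,\operatorname{div}\mathbf v)_{L^2(\Omega)}=\langle\mathbf f,\mathbf v\rangle,\qquad (q,\operatorname{div}\mathbf u)_{L^2(\Omega)}=0$$ for all $\mathbf v\in\mathbf H^1_0(\Omega)$, $q\in L^2_{zmv}(\Omega)$, and let $z_{\mathbf f}\in L^2_{zmv}(\Omega)$ be the scalar potential of $\mathbf f$: $\mathbf f=\nabla z_{\mathbf f}-\Delta\mathbf w$ with $\mathbf w\in\mathbf H^1_0(\Omega)$, $\operatorname{div}\mathbf w=0$ (that is, $(\mathbf w,z_{\mathbf f})$ is the weak solution of the same problem with $\nu=1$). Let $P^{k-1}_{disc}(\mathcal T_h)$ be the space of the functions in $L^2(\Omega)$ that are polynomial of degree at most $k-1$ on each $d$-simplex of $\mathcal T_h$, $Q_h^{k-1}=P^{k-1}_{disc}(\mathcal T_h)\cap L^2_{zmv}(\Omega)$, and let $\mathbf V^k_{0,h}$ be the space of the fields in $\mathbf H^1_0(\Omega)$ whose components are polynomial of degree at most $k$ on each $d$-simplex of $\mathcal T_h$. Let $\Pi_{h,cg}$ be the $L^2(\Omega)^d$-orthogonal projection onto $\mathbf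 V^k_{0,h}$ and $\Pi_{h,dg}$ the $L^2(\Omega)$-orthogonal projection onto $P^{k-1}_{disc}(\mathcal T_h)$. Let $(\mathbf u_h,p_h)\in\mathbf V^k_{0,h}\times Q^{k-1}_h$ solve, for all $(\mathbf v_h,q_h)\in\mathbf V^k_{0,h}\times Q^{k-1}_h$, $$\nu\lambda(\mathbf u_h,\mathbf v_h)_{\mathbf H^1_0(\Omega)}-\lambda(p_h,\operatorname{div}\mathbf v_h)_{L^2(\Omega)}=\lambda\langle\mathbf f,\mathbf v_h\rangle,$$ $$\lambda(q_h,\operatorname{div}\mathbf u_h)_{L^2(\Omega)}+\nu^{-1}(p_h,q_h)_{L^2(\Omega)}=\nu^{-1}(z_{\mathbf f},q_h)_{L^2(\Omega)}.$$ Then $$\|(\mathbf u_h-\mathbf u,\;p_h-\Pi_{h,dg}z_{\mathbf f})\|_{\mathcal X,\sqrt\lambda\,\nu}\le\sqrt{1+d\lambda}\;\|\mathbf u-\Pi_{h,cg}\mathbf u\|_{\mathbf H^1_0(\Omega)},$$ a bound that does not involve the pressure. If moreover $\mathbf u\in (P^k(\Omega))^d$, i.e. every component of $\mathbf u$ is on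 $\Omega$ a single polynomial of degree at most $k$, then $\mathbf u_h=\mathbf u$ and $p_h=\Pi_{h,dg}z_{\mathbf f}$. -/

import Mathlib

open MeasureTheory
open scoped ContDiff

noncomputable section

namespace StokesFE

/-! ### Lebesgue and Sobolev spaces -/

/-- The Euclidean space `ℝ^d`. -/
abbrev E (d : ℕ) := EuclideanSpace ℝ (Fin d)

/-- `L²(Ω)`, with Lebesgue measure. -/
abbrev L2 {d : ℕ} (Ω : Set (E d)) := Lp ℝ 2 (volume.restrict Ω)

/-- `φ` is a test function on `Ω`: smooth, with compact support contained in `Ω`. -/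
def IsTest {d : ℕ} (Ω : Set (E d)) (φ : E d → ℝ) : Prop :=
  ContDiff ℝ ∞ φ ∧ HasCompactSupport φ ∧ tsupport φ ⊆ Ω

theorem IsTest.zero {d : ℕ} (Ω : Set (E d)) : IsTest Ω (fun _ => (0 : ℝ)) := by
  refine ⟨contDiff_const, HasCompactSupport.zero, ?_⟩
  rw [tsupport]
  simp [Function.support]

theorem IsTest.add {d : ℕ} {Ω : Set (E d)} {φ ψ : E d → ℝ}
    (hφ : IsTest Ω φ) (hψ : IsTest Ω ψ) : IsTest Ω (φ + ψ) :=
  ⟨hφ.1.add hψ.1, hφ.2.1.add hψ.2.1,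
    (tsupport_add φ ψ).trans (Set.union_subset hφ.2.2 hψ.2.2)⟩

theorem IsTest.smul {d : ℕ} {Ω : Set (E d)} {φ : E d → ℝ} (c : ℝ)
    (hφ : IsTest Ω φ) : IsTest Ω (c • φ) := by
  refine ⟨contDiff_const.smul hφ.1, hφ.2.1.mono ?_, (closure_mono ?_).trans hφ.2.2⟩ <;>
  · intro x hx hx'
    exact hx (by simp [hx'])

/-- The classical partial derivative `∂_j φ`. -/
def partialDeriv {d : ℕ} (j : Fin d) (φ : E d → ℝ) (x : E d) : ℝ :=
  fderiv ℝ φ x (EuclideanSpace.single j 1)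

/-- `g` is the weak partial derivative `∂_j v` on `Ω`. -/
def HasWeakPartial {d : ℕ} (Ω : Set (E d)) (j : Fin d) (v g : L2 Ω) : Prop :=
  ∀ φ : E d → ℝ, IsTest Ω φ →
    ∫ x in Ω, v x * partialDeriv j φ x = -∫ x in Ω, g x * φ x

theorem IsTest.memLp {d : ℕ} {Ω : Set (E d)} {φ : E d → ℝ} (hφ : IsTest Ω φ) :
    MemLp φ 2 (volume.restrict Ω) :=
  (hφ.1.continuous.memLp_of_hasCompactSupport hφ.2.1)

theorem IsTest.memLp_partialDeriv {d : ℕ} {Ω : Set (E d)} {φ : E d → ℝ} (hφ : IsTest Ω φ)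
    (j : Fin d) : MemLp (partialDeriv j φ) 2 (volume.restrict Ω) := by
  have h1 : Continuous (partialDeriv j φ) :=
    (hφ.1.continuous_fderiv (by simp)).clm_apply continuous_const
  have h2 : HasCompactSupport (partialDeriv j φ) := by
    refine (hφ.2.1.fderiv (𝕜 := ℝ)).mono ?_
    intro x hx hx'
    exact hx (by simp [partialDeriv, hx'])
  exact h1.memLp_of_hasCompactSupport h2

theorem integral_add_mul {d : ℕ} {Ω : Set (E d)} (v w : L2 Ω) {ψ : E d → ℝ}
    (hψ : MemLp ψ 2 (volume.restrict Ω)) :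
    ∫ x in Ω, (v + w) x * ψ x = (∫ x in Ω, v x * ψ x) + ∫ x in Ω, w x * ψ x := by
  have hv : Integrable (fun x => v x * ψ x) (volume.restrict Ω) :=
    MemLp.integrable_mul (Lp.memLp v) hψ
  have hw : Integrable (fun x => w x * ψ x) (volume.restrict Ω) :=
    MemLp.integrable_mul (Lp.memLp w) hψ
  rw [← integral_add hv hw]
  refine integral_congr_ae ?_
  filter_upwards [Lp.coeFn_add v w] with x hx
  rw [hx, Pi.add_apply, add_mul]

theorem integral_smul_mul {d : ℕ} {Ω : Set (E d)} (c : ℝ) (v : L2 Ω) (ψ : E d → ℝ) :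
    ∫ x in Ω, (c • v) x * ψ x = c * ∫ x in Ω, v x * ψ x := by
  rw [← integral_const_mul]
  refine integral_congr_ae ?_
  filter_upwards [Lp.coeFn_smul c v] with x hx
  rw [hx, Pi.smul_apply, smul_eq_mul, mul_assoc]

theorem integral_zero_mul {d : ℕ} {Ω : Set (E d)} (ψ : E d → ℝ) :
    ∫ x in Ω, (0 : L2 Ω) x * ψ x = 0 := by
  simpa using integral_smul_mul (0 : ℝ) (0 : L2 Ω) ψ

/-- The Sobolev space `H¹(Ω)`: an element is a function `v ∈ L²(Ω)` together with its weak
gradient `(∂_j v)_j ∈ L²(Ω)^d` (which `v` determines when `Ω` is open). The topology induced by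
`L²(Ω) × L²(Ω)^d` is the one of the usual norm of `H¹(Ω)`. -/
def H1 {d : ℕ} (Ω : Set (E d)) : Submodule ℝ (L2 Ω × (Fin d → L2 Ω)) where
  carrier := {v | ∀ j, HasWeakPartial Ω j v.1 (v.2 j)}
  add_mem' := by
    intro v w hv hw j φ hφ
    have h1 := hv j φ hφ
    have h2 := hw j φ hφ
    simp only [Prod.fst_add, Prod.snd_add, Pi.add_apply]
    rw [integral_add_mul _ _ (hφ.memLp_partialDeriv j), integral_add_mul _ _ hφ.memLp, h1, h2]
    ring
  zero_mem' := by
    intro j φ _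
    simp only [Prod.fst_zero, Prod.snd_zero, Pi.zero_apply]
    rw [integral_zero_mul, integral_zero_mul, neg_zero]
  smul_mem' := by
    intro c v hv j φ hφ
    have h1 := hv j φ hφ
    simp only [Prod.smul_fst, Prod.smul_snd, Pi.smul_apply]
    rw [integral_smul_mul, integral_smul_mul, h1]
    ring

/-- The elements of `H¹(Ω)` that are test functions on `Ω`. -/
def testH1 {d : ℕ} (Ω : Set (E d)) : Submodule ℝ (H1 Ω) where
  carrier := {v | ∃ φ : E d → ℝ, IsTest Ω φ ∧ v.1.1 =ᵐ[volume.restrict Ω] φ}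
  add_mem' := by
    rintro v w ⟨φ, hφ, hv⟩ ⟨ψ, hψ, hw⟩
    exact ⟨φ + ψ, hφ.add hψ, (Lp.coeFn_add v.1.1 w.1.1).trans (hv.add hw)⟩
  zero_mem' := ⟨fun _ => 0, IsTest.zero Ω, Lp.coeFn_zero ℝ 2 (volume.restrict Ω)⟩
  smul_mem' := by
    rintro c v ⟨φ, hφ, hv⟩
    exact ⟨c • φ, hφ.smul c, (Lp.coeFn_smul c v.1.1).trans (hv.const_smul c)⟩

/-- `H¹₀(Ω)`: the closure of the test functions in `H¹(Ω)`. -/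
def H10 {d : ℕ} (Ω : Set (E d)) : Submodule ℝ (H1 Ω) := (testH1 Ω).topologicalClosure

/-- The embedding `H¹₀(Ω) → L²(Ω)`. -/
def val {d : ℕ} (Ω : Set (E d)) : H10 Ω →ₗ[ℝ] L2 Ω :=
  LinearMap.fst ℝ _ _ ∘ₗ (H1 Ω).subtype ∘ₗ (H10 Ω).subtype

/-- The weak partial derivative `∂_j : H¹₀(Ω) → L²(Ω)`. -/
def pd {d : ℕ} (Ω : Set (E d)) (j : Fin d) : H10 Ω →ₗ[ℝ] L2 Ω :=
  LinearMap.proj j ∘ₗ LinearMap.snd ℝ _ _ ∘ₗ (H1 Ω).subtype ∘ₗ (H10 Ω).subtype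

/-- The space of vector fields `H¹₀(Ω)^d`. -/
abbrev H10Vec {d : ℕ} (Ω : Set (E d)) := Fin d → H10 Ω

/-- The divergence `H¹₀(Ω)^d → L²(Ω)`. -/
def divg {d : ℕ} {Ω : Set (E d)} (v : H10Vec Ω) : L2 Ω := ∑ i, pd Ω i (v i)

/-- The inner product `(v, w) = ∑_{i,j} (∂_j v_i, ∂_j w_i)_{L²}` of `H¹₀(Ω)^d`. -/
def inner10 {d : ℕ} {Ω : Set (E d)} (v w : H10Vec Ω) : ℝ :=
  ∑ i, ∑ j, inner ℝ (pd Ω j (v i)) (pd Ω j (w i))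

/-- The norm of `H¹₀(Ω)^d`: the `L²` norm of the gradient. -/
def norm10 {d : ℕ} {Ω : Set (E d)} (v : H10Vec Ω) : ℝ := Real.sqrt (inner10 v v)

/-- `H⁻¹(Ω)^d`, the dual of `H¹₀(Ω)^d`. -/
abbrev Hm1Vec {d : ℕ} (Ω : Set (E d)) := StrongDual ℝ (H10Vec Ω)

/-- The functions in `L²(Ω)` with zero mean value. -/
def L2zmv {d : ℕ} (Ω : Set (E d)) : Set (L2 Ω) := {q | ∫ x in Ω, q x = 0}

/-- The norm `(‖v‖² + ν⁻² ‖q‖²)^{1/2}` on `H¹₀(Ω)^d × L²(Ω)`. -/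
def normX {d : ℕ} {Ω : Set (E d)} (ν : ℝ) (v : H10Vec Ω) (q : L2 Ω) : ℝ :=
  Real.sqrt (norm10 v ^ 2 + (ν ^ 2)⁻¹ * ‖q‖ ^ 2)

/-! ### The Stokes problem -/

/-- `(u, p)` solves the incompressible Stokes problem `-ν Δu + ∇p = f`, `div u = 0` in `Ω`,
`u = 0` on the boundary, `∫ p = 0`, in its variational form. -/
structure IsStokesSolution {d : ℕ} {Ω : Set (E d)} (ν : ℝ) (f : Hm1Vec Ω)
    (u : H10Vec Ω) (p : L2 Ω) : Prop where
  zero_mean : p ∈ L2zmv Ω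
  momentum : ∀ v : H10Vec Ω, ν * inner10 u v - inner ℝ p (divg v) = f v
  mass : ∀ q ∈ L2zmv Ω, inner ℝ q (divg u) = 0

/-- `z` is the scalar potential `z_f` of `f`, i.e. `f = ∇z - Δw` with `z ∈ L²(Ω)` of zero mean
value and `w ∈ H¹₀(Ω)^d` divergence free. -/
def IsPotential {d : ℕ} {Ω : Set (E d)} (f : Hm1Vec Ω) (z : L2 Ω) : Prop :=
  ∃ w : H10Vec Ω, IsStokesSolution 1 f w z

/-! ### The discretization -/

/-- A (conforming, finite) simplicial triangulation of `Ω ⊆ ℝ^d`: a finite simplicial complex,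
all of whose faces are faces of `d`-simplices, and whose union is the closure of `Ω`. -/
structure Triangulation {d : ℕ} (Ω : Set (E d)) where
  complex : Geometry.SimplicialComplex ℝ (E d)
  finite_faces : complex.faces.Finite
  pure : ∀ s ∈ complex.faces, ∃ t ∈ complex.faces, s ⊆ t ∧ t.card = d + 1
  space_eq : complex.space = closure Ω

/-- The cells of a triangulation: the sets of vertices of its `d`-simplices. -/
def Triangulation.cells {d : ℕ} {Ω : Set (E d)} (𝒯 : Triangulation Ω) : Set (Finset (E d)) :=
  {s | s ∈ 𝒯.complex.faces ∧ s.card = d + 1}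

/-- The value of a polynomial at a point of `ℝ^d`. -/
def evalPoly {d : ℕ} (P : MvPolynomial (Fin d) ℝ) (x : E d) : ℝ :=
  MvPolynomial.eval (fun i => x i) P

/-- `q` coincides on (the part in `Ω` of) the simplex `T` with vertices `s` with `P`. -/
def AgreesOn {d : ℕ} {Ω : Set (E d)} (q : L2 Ω) (s : Finset (E d))
    (P : MvPolynomial (Fin d) ℝ) : Prop :=
  ∀ᵐ x ∂(volume.restrict Ω), x ∈ convexHull ℝ (s : Set (E d)) → q x = evalPoly P x

theorem AgreesOn.add {d : ℕ} {Ω : Set (E d)} {q r : L2 Ω} {s : Finset (E d)}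
    {P Q : MvPolynomial (Fin d) ℝ} (hq : AgreesOn q s P) (hr : AgreesOn r s Q) :
    AgreesOn (q + r) s (P + Q) := by
  filter_upwards [hq, hr, Lp.coeFn_add q r] with x h1 h2 h3 hx
  rw [h3, Pi.add_apply, h1 hx, h2 hx, evalPoly, evalPoly, evalPoly, map_add]

theorem AgreesOn.smul {d : ℕ} {Ω : Set (E d)} {q : L2 Ω} {s : Finset (E d)}
    {P : MvPolynomial (Fin d) ℝ} (c : ℝ) (hq : AgreesOn q s P) :
    AgreesOn (c • q) s (c • P) := by
  filter_upwards [hq, Lp.coeFn_smul c q] with x h1 h3 hx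
  simp [h3, h1 hx, evalPoly]

theorem AgreesOn.zero {d : ℕ} {Ω : Set (E d)} (s : Finset (E d)) :
    AgreesOn (0 : L2 Ω) s 0 := by
  filter_upwards [Lp.coeFn_zero ℝ 2 (volume.restrict Ω)] with x h3 _
  rw [h3, evalPoly, map_zero, Pi.zero_apply]

/-- The broken polynomial space `P^k_disc(𝒯)`. -/
def Pdisc {d : ℕ} {Ω : Set (E d)} (𝒯 : Triangulation Ω) (k : ℕ) : Submodule ℝ (L2 Ω) where
  carrier := {q | ∀ s ∈ 𝒯.cells, ∃ P : MvPolynomial (Fin d) ℝ,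
    P.totalDegree ≤ k ∧ AgreesOn q s P}
  add_mem' := by
    intro q r hq hr s hs
    obtain ⟨P, hP, h1⟩ := hq s hs
    obtain ⟨Q, hQ, h2⟩ := hr s hs
    exact ⟨P + Q, (MvPolynomial.totalDegree_add P Q).trans (max_le hP hQ), h1.add h2⟩
  zero_mem' := fun s _ => ⟨0, by simp, AgreesOn.zero s⟩
  smul_mem' := by
    intro c q hq s hs
    obtain ⟨P, hP, h1⟩ := hq s hs
    exact ⟨c • P, (MvPolynomial.totalDegree_smul_le c P).trans hP, h1.smul c⟩

theorem Triangulation.ae_mem_cell {d : ℕ} {Ω : Set (E d)} (𝒯 : Triangulation Ω) :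
    ∀ᵐ x ∂(volume.restrict Ω), ∃ s ∈ 𝒯.cells, x ∈ convexHull ℝ (s : Set (E d)) := by
  have h : ∀ᵐ x ∂(volume.restrict (closure Ω)), x ∈ closure Ω :=
    ae_restrict_mem isClosed_closure.measurableSet
  filter_upwards [ae_restrict_of_ae_restrict_of_subset subset_closure h] with x hx
  rw [← 𝒯.space_eq, Geometry.SimplicialComplex.mem_space_iff] at hx
  obtain ⟨s, hs, hxs⟩ := hx
  obtain ⟨t, ht, hst, hc⟩ := 𝒯.pure s hs
  exact ⟨t, ⟨ht, hc⟩, convexHull_mono (by exact_mod_cast hst) hxs⟩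

theorem Triangulation.finite_cells {d : ℕ} {Ω : Set (E d)} (𝒯 : Triangulation Ω) :
    𝒯.cells.Finite := 𝒯.finite_faces.subset fun _ h => h.1

/-- The broken polynomial space is finite dimensional. -/
instance {d : ℕ} {Ω : Set (E d)} (𝒯 : Triangulation Ω) (k : ℕ) :
    FiniteDimensional ℝ (Pdisc 𝒯 k) := by
  classical
  have : Finite 𝒯.cells := 𝒯.finite_cells
  let W := 𝒯.cells → MvPolynomial.restrictTotalDegree (Fin d) ℝ k
  let S : Submodule ℝ (L2 Ω × W) :=
    { carrier := {a | ∀ s : 𝒯.cells, AgreesOn a.1 s.1 (a.2 s).1}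
      add_mem' := fun ha hb s => (ha s).add (hb s)
      zero_mem' := fun s => AgreesOn.zero s.1
      smul_mem' := fun c _ ha s => (ha s).smul c }
  have hinj : Function.Injective (LinearMap.snd ℝ (L2 Ω) W ∘ₗ S.subtype) := by
    rintro ⟨⟨q, P⟩, hq⟩ ⟨⟨r, Q⟩, hr⟩ h
    have hPQ : P = Q := h
    subst hPQ
    have hqr : q = r := by
      apply Lp.ext
      have h1 : ∀ᵐ x ∂(volume.restrict Ω), ∀ s : 𝒯.cells,
          x ∈ convexHull ℝ (s.1 : Set (E d)) → q x = evalPoly (P s).1 x :=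
        ae_all_iff.2 hq
      have h2 : ∀ᵐ x ∂(volume.restrict Ω), ∀ s : 𝒯.cells,
          x ∈ convexHull ℝ (s.1 : Set (E d)) → r x = evalPoly (P s).1 x :=
        ae_all_iff.2 hr
      filter_upwards [h1, h2, 𝒯.ae_mem_cell] with x h1 h2 ⟨s, hs, hx⟩
      rw [h1 ⟨s, hs⟩ hx, h2 ⟨s, hs⟩ hx]
    subst hqr
    rfl
  have : FiniteDimensional ℝ W := inferInstance
  have : FiniteDimensional ℝ S := FiniteDimensional.of_injective _ hinj
  have hle : Pdisc 𝒯 k ≤ S.map (LinearMap.fst ℝ (L2 Ω) W) := by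
    intro q hq
    choose P hP hA using fun s : 𝒯.cells => hq s.1 s.2
    exact ⟨(q, fun s => ⟨P s, (MvPolynomial.mem_restrictTotalDegree _ _ _).2 (hP s)⟩),
      fun s => hA s, rfl⟩
  exact Submodule.finiteDimensional_of_le hle

/-- The space `V^k_{0,h}` of the Lagrange functions of order `k` with zero boundary values: the
functions in `H¹₀(Ω)` that are polynomial of degree at most `k` on each cell. -/
def V0h {d : ℕ} {Ω : Set (E d)} (𝒯 : Triangulation Ω) (k : ℕ) : Submodule ℝ (H10 Ω) :=
  (Pdisc 𝒯 k).comap (val Ω)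

/-- The space of vector fields `(V^k_{0,h})^d`. -/
def V0hVec {d : ℕ} {Ω : Set (E d)} (𝒯 : Triangulation Ω) (k : ℕ) :
    Submodule ℝ (H10Vec Ω) :=
  Submodule.pi Set.univ fun _ => V0h 𝒯 k

/-- The discrete pressures `Q^k_h`: broken polynomials with zero mean value. -/
def Qh {d : ℕ} {Ω : Set (E d)} (𝒯 : Triangulation Ω) (k : ℕ) : Set (L2 Ω) :=
  {q | q ∈ Pdisc 𝒯 k ∧ q ∈ L2zmv Ω}

/-- `(u_h, p_h)` solves the discrete problem with the `P^k × P^{k-1}_disc` finite element, viscosity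
`ν`, parameter `lam`, right-hand side `f` and potential `z`. -/
structure IsDiscreteSolution {d : ℕ} {Ω : Set (E d)} (𝒯 : Triangulation Ω) (k : ℕ)
    (ν lam : ℝ) (f : Hm1Vec Ω) (z : L2 Ω) (uh : H10Vec Ω) (ph : L2 Ω) : Prop where
  velocity_mem : uh ∈ V0hVec 𝒯 k
  pressure_mem : ph ∈ Qh 𝒯 (k - 1)
  momentum : ∀ v ∈ V0hVec 𝒯 k,
    ν * lam * inner10 uh v - lam * inner ℝ ph (divg v) = lam * f v
  mass : ∀ q ∈ Qh 𝒯 (k - 1),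
    lam * inner ℝ q (divg uh) + ν⁻¹ * inner ℝ ph q = ν⁻¹ * inner ℝ z q

/-- `Π_{h,dg}`: the `L²(Ω)`-orthogonal projection onto `P^{k-1}_disc(𝒯)`. -/
def projDG {d : ℕ} {Ω : Set (E d)} (𝒯 : Triangulation Ω) (k : ℕ) (q : L2 Ω) : L2 Ω :=
  (Pdisc 𝒯 (k - 1)).starProjection q

theorem exists_projCG {d : ℕ} {Ω : Set (E d)} (𝒯 : Triangulation Ω) (k : ℕ)
    (w : Fin d → L2 Ω) :
    ∃ π ∈ V0hVec 𝒯 k, ∀ v ∈ V0hVec 𝒯 k,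
      ∑ i, inner ℝ (w i - val Ω (π i)) (val Ω (v i)) = 0 := by
  have : FiniteDimensional ℝ ((V0h 𝒯 k).map (val Ω)) :=
    Submodule.finiteDimensional_of_le (Submodule.map_comap_le (val Ω) (Pdisc 𝒯 k))
  choose π hπ hπ' using fun i =>
    Submodule.mem_map.1 (Submodule.starProjection_apply_mem ((V0h 𝒯 k).map (val Ω)) (w i))
  refine ⟨π, fun i _ => hπ i, fun v hv => Finset.sum_eq_zero fun i _ => ?_⟩
  rw [hπ' i]
  exact Submodule.starProjection_inner_eq_zero (w i) _
    (Submodule.mem_map_of_mem (hv i (Set.mem_univ i)))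

/-- `Π_{h,cg}`: the `L²(Ω)^d`-orthogonal projection onto `(V^k_{0,h})^d`. -/
def projCG {d : ℕ} {Ω : Set (E d)} (𝒯 : Triangulation Ω) (k : ℕ)
    (w : Fin d → L2 Ω) : H10Vec Ω :=
  (exists_projCG 𝒯 k w).choose

/-- `u ∈ (P^k(Ω))^d`: on `Ω` every component of `u` is one polynomial of degree at most `k`. -/
def IsPolyVec {d : ℕ} {Ω : Set (E d)} (k : ℕ) (u : H10Vec Ω) : Prop :=
  ∀ i, ∃ P : MvPolynomial (Fin d) ℝ, P.totalDegree ≤ k ∧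
    val Ω (u i) =ᵐ[volume.restrict Ω] evalPoly P

end StokesFE

end

open StokesFE

namespace StokesFE

/-! The pressure disappears because `f` can be split in only one way. Both `(u, p)` and the pair
defining the potential represent `f`, and `ν u - w` is divergence free; testing both momentum
equations with it removes both pressures and gives `ν ∇u = ∇w`. Hence `u` satisfies the momentum
equation with `zf` in place of `p` (`IsStokesSolution.momentum_potential`).

Let `e = uh - u`, `r = ph - projDG 𝒯 k zf`, let `π` be any discrete field and `w = u - π`.
Divergences of discrete fields lie in `Pdisc 𝒯 (k - 1)` (`divg_mem_Pdisc`), so against them `zf` and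
its projection are the same. The momentum equations tested with `uh - π = e + w` give `ν (e, e + w)
= (r, div uh + div w)`. The discrete mass equation tested with `r` gives `(r, div uh) = -‖r‖² / (ν
lam)`. Their sum is an energy identity that controls `e` and `r` together, with no inf-sup
condition; Cauchy-Schwarz and `‖div w‖² ≤ d ‖∇w‖²` finish it (`sqrt_norm_sq_add_le`). Of `projCG`
the bound uses only that its values are discrete.

If `u` is polynomial it is itself discrete, so `projCG` reproduces it and the bound is zero; a
Poincaré inequality turns the vanishing gradient of `uh - u` into `uh = u`. -/

/-! ### Derivatives of polynomials -/

theorem totalDegree_pderiv_le {σ : Type*} (j : σ) (P : MvPolynomial σ ℝ) :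
    (MvPolynomial.pderiv j P).totalDegree ≤ P.totalDegree - 1 := by
  classical
  refine Finset.sup_le fun m hm => ?_
  rw [MvPolynomial.mem_support_iff, MvPolynomial.coeff_pderiv] at hm
  -- The coefficient of `m` in the derivative is a multiple of the coefficient of `m + single j 1`
  -- in `P`, so that monomial occurs in `P`.
  have h := MvPolynomial.le_totalDegree
    (MvPolynomial.mem_support_iff.2 (left_ne_zero_of_mul hm))
  rw [Finsupp.sum_add_index' (fun _ => rfl) (fun _ _ _ => rfl),
    Finsupp.sum_single_index rfl] at h
  omega

theorem hasFDerivAt_coord {d : ℕ} (i : Fin d) (x : E d) :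
    HasFDerivAt (fun y : E d => y i) (EuclideanSpace.proj i : E d →L[ℝ] ℝ) x :=
  (EuclideanSpace.proj i : E d →L[ℝ] ℝ).hasFDerivAt

theorem contDiff_evalPoly {d : ℕ} (P : MvPolynomial (Fin d) ℝ) :
    ContDiff ℝ ∞ (evalPoly P) := by
  induction P using MvPolynomial.induction_on with
  | C a =>
    have : evalPoly (MvPolynomial.C a : MvPolynomial (Fin d) ℝ) = fun _ => a := by
      ext x; simp [evalPoly]
    rw [this]; exact contDiff_const
  | add P Q hP hQ =>
    have : evalPoly (P + Q) = fun x => evalPoly P x + evalPoly Q x := by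
      ext x; simp [evalPoly]
    rw [this]; exact hP.add hQ
  | mul_X P i hP =>
    have : evalPoly (P * MvPolynomial.X i) = fun x => evalPoly P x * x i := by
      ext x; simp [evalPoly]
    rw [this]; exact hP.mul (EuclideanSpace.proj i : E d →L[ℝ] ℝ).contDiff

theorem partialDeriv_evalPoly {d : ℕ} (j : Fin d) (P : MvPolynomial (Fin d) ℝ) :
    partialDeriv j (evalPoly P) = evalPoly (MvPolynomial.pderiv j P) := by
  induction P using MvPolynomial.induction_on with
  | C a =>
    have : evalPoly (MvPolynomial.C a : MvPolynomial (Fin d) ℝ) = fun _ => a := by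
      ext x; simp [evalPoly]
    ext x
    rw [this]
    simp [partialDeriv, evalPoly]
  | add P Q hP hQ =>
    have : evalPoly (P + Q) = evalPoly P + evalPoly Q := by
      ext x; simp [evalPoly]
    ext x
    have h1 := congrFun hP x
    have h2 := congrFun hQ x
    rw [partialDeriv] at h1 h2
    rw [this, partialDeriv, fderiv_add ((contDiff_evalPoly P).differentiable (by simp) x)
      ((contDiff_evalPoly Q).differentiable (by simp) x), add_apply, h1, h2]
    simp [evalPoly]
  | mul_X P i hP =>
    have : evalPoly (P * MvPolynomial.X i) = evalPoly P * fun x => x i := by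
      ext x; simp [evalPoly]
    ext x
    have h1 := congrFun hP x
    rw [partialDeriv] at h1
    rw [this, partialDeriv, fderiv_mul ((contDiff_evalPoly P).differentiable (by simp) x)
      (hasFDerivAt_coord i x).differentiableAt, (hasFDerivAt_coord i x).fderiv]
    simp only [add_apply, smul_apply, h1, PiLp.proj_apply, smul_eq_mul]
    rw [evalPoly, evalPoly, evalPoly, MvPolynomial.pderiv_mul, MvPolynomial.pderiv_X]
    by_cases hij : i = j
    · subst hij
      simp; ring
    · simp [hij]; ring

/-! ### Locality of weak derivatives -/

theorem IsTest.mono {d : ℕ} {U Ω : Set (E d)} {φ : E d → ℝ} (hφ : IsTest U φ) (h : U ⊆ Ω) :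
    IsTest Ω φ := ⟨hφ.1, hφ.2.1, hφ.2.2.trans h⟩

theorem IsTest.mul_left {d : ℕ} {Ω : Set (E d)} {φ ψ : E d → ℝ} (hφ : IsTest Ω φ)
    (hψ : ContDiff ℝ ∞ ψ) : IsTest Ω (fun x => ψ x * φ x) :=
  ⟨hψ.mul hφ.1, hφ.2.1.mul_left, (tsupport_mul_subset_right).trans hφ.2.2⟩

theorem continuous_partialDeriv {d : ℕ} {ψ : E d → ℝ} (hψ : ContDiff ℝ ∞ ψ) (j : Fin d) :
    Continuous (partialDeriv j ψ) :=
  (hψ.continuous_fderiv (by simp)).clm_apply continuous_const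

theorem tsupport_partialDeriv_subset {d : ℕ} (φ : E d → ℝ) (j : Fin d) :
    tsupport (partialDeriv j φ) ⊆ tsupport φ := by
  have h : Function.support (partialDeriv j φ) ⊆ Function.support (fderiv ℝ φ) :=
    fun x hx hx' => hx (by simp [partialDeriv, hx'])
  exact (closure_mono h).trans (tsupport_fderiv_subset ℝ)

/-- Both integrands vanish outside `Ω`, so this is integration by parts on the whole space; no
regularity of `Ω` enters. -/
theorem IsTest.integral_mul_partialDeriv {d : ℕ} {Ω : Set (E d)} {φ ψ : E d → ℝ}
    (hφ : IsTest Ω φ) (hψ : ContDiff ℝ ∞ ψ) (j : Fin d) :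
    ∫ x in Ω, ψ x * partialDeriv j φ x = -∫ x in Ω, partialDeriv j ψ x * φ x := by
  have hs := tsupport_partialDeriv_subset φ j
  have hc : HasCompactSupport (partialDeriv j φ) := hφ.2.1.mono' (subset_tsupport _ |>.trans hs)
  have hcφ := hφ.1.continuous
  rw [setIntegral_eq_integral_of_forall_compl_eq_zero,
    setIntegral_eq_integral_of_forall_compl_eq_zero]
  · refine integral_mul_fderiv_eq_neg_fderiv_mul_of_integrable ?_ ?_ ?_
      (fun x _ => hψ.differentiable (by simp) x) (fun x _ => hφ.1.differentiable (by simp) x)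
    · exact ((continuous_partialDeriv hψ j).mul hcφ).integrable_of_hasCompactSupport
        hφ.2.1.mul_left
    · exact (hψ.continuous.mul (continuous_partialDeriv hφ.1 j)).integrable_of_hasCompactSupport
        hc.mul_left
    · exact (hψ.continuous.mul hcφ).integrable_of_hasCompactSupport hφ.2.1.mul_left
  · intro x hx
    rw [image_eq_zero_of_notMem_tsupport fun h => hx (hφ.2.2 h), mul_zero]
  · intro x hx
    rw [image_eq_zero_of_notMem_tsupport fun h => hx (hφ.2.2 (hs h)), mul_zero]

/-- A weak derivative is local: it agrees with the classical one where the function is smooth. -/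
theorem HasWeakPartial.ae_eq_partialDeriv {d : ℕ} {U Ω : Set (E d)} {j : Fin d} {v g : L2 Ω}
    (h : HasWeakPartial Ω j v g) (hU : IsOpen U) (hUΩ : U ⊆ Ω) {ψ : E d → ℝ}
    (hψ : ContDiff ℝ ∞ ψ) (hv : ∀ᵐ x ∂(volume.restrict Ω), x ∈ U → v x = ψ x) :
    ∀ᵐ x ∂(volume.restrict Ω), x ∈ U → g x = partialDeriv j ψ x := by
  have hcψ := continuous_partialDeriv hψ j
  have hg : LocallyIntegrable g (volume.restrict Ω) :=
    (Lp.memLp g).locallyIntegrable (by norm_num)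
  -- Fundamental lemma of the calculus of variations on `U`: test functions on `U` are also test
  -- functions on `Ω`, and they see `v` only where it equals `ψ`.
  have key := hU.ae_eq_zero_of_integral_contDiff_smul_eq_zero
    (f := fun x => g x - partialDeriv j ψ x) (μ := volume.restrict Ω)
    ((hg.sub hcψ.locallyIntegrable).locallyIntegrableOn U) ?_
  · filter_upwards [key] with x hx hxU
    exact sub_eq_zero.1 (hx hxU)
  · intro φ h1 h2 h3
    have hφ : IsTest U φ := ⟨h1, h2, h3⟩
    have hφΩ := hφ.mono hUΩ
    have e1 : ∫ x in Ω, v x * partialDeriv j φ x = ∫ x in Ω, ψ x * partialDeriv j φ x := by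
      refine integral_congr_ae ?_
      filter_upwards [hv] with x hx
      by_cases hxU : x ∈ U
      · rw [hx hxU]
      · rw [image_eq_zero_of_notMem_tsupport
          fun h => hxU (h3 (tsupport_partialDeriv_subset φ j h)), mul_zero, mul_zero]
    have e2 := h φ hφΩ
    have e3 := hφΩ.integral_mul_partialDeriv hψ j
    have i1 : Integrable (fun x => g x * φ x) (volume.restrict Ω) :=
      MemLp.integrable_mul (Lp.memLp g) hφΩ.memLp
    have i2 : Integrable (fun x => partialDeriv j ψ x * φ x) (volume.restrict Ω) :=
      (hcψ.mul h1.continuous).integrable_of_hasCompactSupport h2.mul_left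
    have : ∀ x, φ x • (g x - partialDeriv j ψ x) = g x * φ x - partialDeriv j ψ x * φ x := by
      intro x; rw [smul_eq_mul]; ring
    simp_rw [this]
    rw [integral_sub i1 i2]
    linarith

theorem pd_ae_eq {d : ℕ} {U Ω : Set (E d)} (hU : IsOpen U) (hUΩ : U ⊆ Ω) (v : H10 Ω)
    {ψ : E d → ℝ} (hψ : ContDiff ℝ ∞ ψ)
    (hv : ∀ᵐ x ∂(volume.restrict Ω), x ∈ U → val Ω v x = ψ x) (j : Fin d) :
    ∀ᵐ x ∂(volume.restrict Ω), x ∈ U → pd Ω j v x = partialDeriv j ψ x :=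
  (v.1.2 j).ae_eq_partialDeriv hU hUΩ hψ hv

/-- An element of `H10 Ω` carries its gradient as separate data; locality with `ψ = 0` shows that
the function determines it. -/
theorem pd_eq_zero_of_val_eq_zero {d : ℕ} {Ω : Set (E d)} (hΩ : IsOpen Ω) {v : H10 Ω}
    (hv : val Ω v = 0) (j : Fin d) : pd Ω j v = 0 := by
  have h := pd_ae_eq hΩ subset_rfl v (ψ := fun _ => 0) contDiff_const (by
    rw [hv]
    filter_upwards [Lp.coeFn_zero ℝ 2 (volume.restrict Ω)] with x hx _
    rw [hx, Pi.zero_apply]) j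
  apply Lp.ext
  filter_upwards [h, ae_restrict_mem hΩ.measurableSet, Lp.coeFn_zero ℝ 2 (volume.restrict Ω)]
    with x hx hxΩ h0
  rw [hx hxΩ, h0]
  simp [partialDeriv]

theorem pd_mem_Pdisc {d : ℕ} {Ω : Set (E d)} (hΩ : IsOpen Ω) (𝒯 : Triangulation Ω) {k : ℕ}
    {v : H10 Ω} (hv : v ∈ V0h 𝒯 k) (j : Fin d) : pd Ω j v ∈ Pdisc 𝒯 (k - 1) := by
  intro s hs
  obtain ⟨P, hP, hA⟩ := hv s hs
  refine ⟨MvPolynomial.pderiv j P,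
    (totalDegree_pderiv_le j P).trans (Nat.sub_le_sub_right hP 1), ?_⟩
  -- Locality needs an open set, hence the interior of the simplex; the frontier of a convex set is
  -- null.
  have hfr : ∀ᵐ x ∂(volume.restrict Ω), x ∉ frontier (convexHull ℝ (s : Set (E d))) :=
    ae_restrict_of_ae (measure_eq_zero_iff_ae_notMem.1
      ((convex_convexHull ℝ (s : Set (E d))).addHaar_frontier volume))
  have h := pd_ae_eq (isOpen_interior.inter hΩ)
    (U := interior (convexHull ℝ (s : Set (E d))) ∩ Ω)
    Set.inter_subset_right v (contDiff_evalPoly P) (by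
      filter_upwards [hA] with x hx hxU
      exact hx (interior_subset hxU.1)) j
  filter_upwards [h, hfr, ae_restrict_mem hΩ.measurableSet] with x hx hxf hxΩ hxs
  rw [hx ⟨?_, hxΩ⟩, partialDeriv_evalPoly]
  by_contra hxi
  exact hxf ⟨subset_closure hxs, hxi⟩

/-! ### Density of test functions, zero means and the Poincaré inequality -/

/-- Density argument: a closed condition on a function and its weak derivative passes from test
functions, where by locality the derivative is classical, to `H10 Ω`. -/
theorem H10_induction_closed {d : ℕ} {Ω : Set (E d)} (hΩ : IsOpen Ω) (j : Fin d)
    {C : Set (L2 Ω × L2 Ω)} (hC : IsClosed C)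
    (h : ∀ v g : L2 Ω, ∀ φ, IsTest Ω φ → v =ᵐ[volume.restrict Ω] φ →
      g =ᵐ[volume.restrict Ω] partialDeriv j φ → (v, g) ∈ C) (v : H10 Ω) :
    (val Ω v, pd Ω j v) ∈ C := by
  have hcont : Continuous fun w : H1 Ω => (w.1.1, w.1.2 j) := by fun_prop
  have hsub : (testH1 Ω : Set (H1 Ω)) ⊆ (fun w : H1 Ω => (w.1.1, w.1.2 j)) ⁻¹' C := by
    rintro w ⟨φ, hφ, hw⟩
    refine h _ _ φ hφ hw ?_
    filter_upwards [(w.2 j).ae_eq_partialDeriv hΩ subset_rfl hφ.1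
      (hw.mono fun x hx _ => hx), ae_restrict_mem hΩ.measurableSet] with x hx hxΩ
    exact hx hxΩ
  exact closure_minimal hsub (hC.preimage hcont) v.2

theorem inner_L2_eq {d : ℕ} {Ω : Set (E d)} (v w : L2 Ω) :
    inner ℝ v w = ∫ x in Ω, v x * w x := by
  rw [L2.inner_def]
  refine integral_congr_ae (.of_forall fun x => ?_)
  simp [mul_comm]

theorem memLp_one {d : ℕ} {Ω : Set (E d)} (hΩb : Bornology.IsBounded Ω) :
    MemLp (fun _ : E d => (1 : ℝ)) 2 (volume.restrict Ω) := by
  have : IsFiniteMeasure (volume.restrict Ω) := ⟨by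
    simpa using hΩb.measure_lt_top⟩
  exact memLp_const 1

/-- The constant function one in `L²(Ω)`, for a bounded `Ω`. -/
noncomputable def oneL2 {d : ℕ} {Ω : Set (E d)} (hΩb : Bornology.IsBounded Ω) : L2 Ω :=
  (memLp_one hΩb).toLp _

theorem inner_oneL2 {d : ℕ} {Ω : Set (E d)} (hΩb : Bornology.IsBounded Ω) (q : L2 Ω) :
    inner ℝ (oneL2 hΩb) q = ∫ x in Ω, q x := by
  rw [inner_L2_eq]
  refine integral_congr_ae ?_
  filter_upwards [(memLp_one hΩb).coeFn_toLp] with x hx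
  rw [oneL2, hx, one_mul]

theorem mem_L2zmv_iff {d : ℕ} {Ω : Set (E d)} (hΩb : Bornology.IsBounded Ω) (q : L2 Ω) :
    q ∈ L2zmv Ω ↔ inner ℝ (oneL2 hΩb) q = 0 := by
  rw [inner_oneL2]; rfl

theorem oneL2_mem_Pdisc {d : ℕ} {Ω : Set (E d)} (hΩb : Bornology.IsBounded Ω)
    (𝒯 : Triangulation Ω) (k : ℕ) : oneL2 hΩb ∈ Pdisc 𝒯 k := by
  intro s _
  refine ⟨1, by simp, ?_⟩
  filter_upwards [(memLp_one hΩb).coeFn_toLp] with x hx _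
  rw [oneL2, hx]
  simp [evalPoly]

theorem inner_oneL2_pd {d : ℕ} {Ω : Set (E d)} (hΩ : IsOpen Ω) (hΩb : Bornology.IsBounded Ω)
    (v : H10 Ω) (j : Fin d) : inner ℝ (oneL2 hΩb) (pd Ω j v) = 0 := by
  refine H10_induction_closed hΩ j (C := {a | inner ℝ (oneL2 hΩb) a.2 = 0})
    (isClosed_eq (by fun_prop) continuous_const) ?_ v
  intro v g φ hφ _ hg
  have h := hφ.integral_mul_partialDeriv (ψ := fun _ => 1) contDiff_const j
  simp only [Set.mem_ofPred_eq, inner_oneL2]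
  rw [integral_congr_ae hg]
  simpa [partialDeriv] using h

/-- Poincaré inequality, from `∫ φ² = ∫ (∂_j x_j) φ² = -2 ∫ x_j φ ∂_j φ` and `|x_j| ≤ R` on `Ω`. The
factor `‖v‖` is not cancelled: the condition is closed as it stands. -/
theorem norm_sq_le_of_isTest {d : ℕ} {Ω : Set (E d)} (hΩ : IsOpen Ω) {R : ℝ}
    (hR : ∀ x ∈ Ω, ‖x‖ ≤ R) (j : Fin d) {v g : L2 Ω} {φ : E d → ℝ} (hφ : IsTest Ω φ)
    (hv : v =ᵐ[volume.restrict Ω] φ) (hg : g =ᵐ[volume.restrict Ω] partialDeriv j φ) :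
    ‖v‖ ^ 2 ≤ 2 * R * (‖v‖ * ‖g‖) := by
  have hx : ContDiff ℝ ∞ (fun x : E d => x j) :=
    (EuclideanSpace.proj j : E d →L[ℝ] ℝ).contDiff
  have h := (hφ.mul_left hφ.1).integral_mul_partialDeriv hx j
  have hpx : ∀ x : E d, partialDeriv j (fun x : E d => x j) x = 1 := by
    intro x
    rw [partialDeriv, (hasFDerivAt_coord j x).fderiv]; simp
  have hpφ : ∀ x, partialDeriv j (fun x => φ x * φ x) x = 2 * (φ x * partialDeriv j φ x) := by
    intro x
    have hd := hφ.1.differentiable (by simp) x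
    rw [partialDeriv, fderiv_fun_mul hd hd]
    simp [partialDeriv]; ring
  simp_rw [hpx, hpφ, one_mul] at h
  have hn : ‖v‖ ^ 2 = ∫ x in Ω, φ x * φ x := by
    rw [← real_inner_self_eq_norm_sq, inner_L2_eq]
    refine integral_congr_ae ?_
    filter_upwards [hv] with x hx
    rw [hx]
  have hm : MemLp (fun x => x j * g x) 2 (volume.restrict Ω) := by
    refine (Lp.memLp g).of_le_mul (c := R) ?_ ?_
    · exact hx.continuous.aestronglyMeasurable.mul (Lp.aestronglyMeasurable g)
    · filter_upwards [ae_restrict_mem hΩ.measurableSet] with x hxΩ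
      rw [norm_mul]
      exact mul_le_mul_of_nonneg_right ((PiLp.norm_apply_le x j).trans (hR x hxΩ))
        (norm_nonneg _)
  have hmn : ‖hm.toLp‖ ≤ R * ‖g‖ := by
    refine Lp.norm_le_mul_norm_of_ae_le_mul ?_
    filter_upwards [ae_restrict_mem hΩ.measurableSet, hm.coeFn_toLp] with x hxΩ hx'
    rw [hx', norm_mul]
    exact mul_le_mul_of_nonneg_right ((PiLp.norm_apply_le x j).trans (hR x hxΩ))
        (norm_nonneg _)
  have hi : inner ℝ v hm.toLp = ∫ x in Ω, x j * (φ x * partialDeriv j φ x) := by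
    rw [inner_L2_eq]
    refine integral_congr_ae ?_
    filter_upwards [hv, hg, hm.coeFn_toLp] with x h1 h2 h3
    rw [h3, h1, h2]; ring
  have h2 : ∫ x in Ω, x j * (2 * (φ x * partialDeriv j φ x)) = 2 * inner ℝ v hm.toLp := by
    rw [hi, ← integral_const_mul]
    refine integral_congr_ae (.of_forall fun x => ?_)
    ring
  rw [h2, ← hn] at h
  have h3 := neg_le_of_abs_le (abs_real_inner_le_norm v hm.toLp)
  have h4 := mul_le_mul_of_nonneg_left hmn (norm_nonneg v)
  linarith

/-- The Poincaré inequality in the single direction `j₀` kills the function; `j₀` also supplies `0 <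
d`. -/
theorem eq_zero_of_pd_eq_zero {d : ℕ} {Ω : Set (E d)} (hΩ : IsOpen Ω)
    (hΩb : Bornology.IsBounded Ω) (j₀ : Fin d) {v : H10 Ω} (hv : ∀ j, pd Ω j v = 0) : v = 0 := by
  obtain ⟨R, hR⟩ := hΩb.exists_norm_le
  have h := H10_induction_closed hΩ j₀
    (C := {a | ‖a.1‖ ^ 2 ≤ 2 * R * (‖a.1‖ * ‖a.2‖)})
    (isClosed_le (by fun_prop) (by fun_prop))
    (fun v g φ hφ h1 h2 => norm_sq_le_of_isTest hΩ hR j₀ hφ h1 h2) v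
  have h0 : val Ω v = 0 := by
    simp only [Set.mem_ofPred_eq, hv, norm_zero, mul_zero] at h
    exact norm_eq_zero.1 (pow_eq_zero_iff two_ne_zero |>.1 (le_antisymm h (sq_nonneg _)))
  exact Subtype.ext (Subtype.ext (Prod.ext h0 (funext hv)))

/-! ### Gradient and divergence of vector fields -/

/-- The gradient of a vector field, with all its entries collected in one Hilbert space. -/
noncomputable def gradVec {d : ℕ} {Ω : Set (E d)} (v : H10Vec Ω) :
    PiLp 2 fun _ : Fin d × Fin d => L2 Ω :=
  WithLp.toLp 2 fun a => pd Ω a.2 (v a.1)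

theorem gradVec_sub {d : ℕ} {Ω : Set (E d)} (v w : H10Vec Ω) :
    gradVec (v - w) = gradVec v - gradVec w := rfl

theorem gradVec_eq_zero_iff {d : ℕ} {Ω : Set (E d)} {v : H10Vec Ω} :
    gradVec v = 0 ↔ ∀ i j, pd Ω j (v i) = 0 :=
  ⟨fun h i j => congrArg (fun g => g (i, j)) h, fun h => PiLp.ext fun a => h a.1 a.2⟩

theorem inner10_eq {d : ℕ} {Ω : Set (E d)} (v w : H10Vec Ω) :
    inner10 v w = inner ℝ (gradVec v) (gradVec w) := by
  rw [PiLp.inner_apply, Fintype.sum_prod_type]; rfl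

theorem norm10_eq {d : ℕ} {Ω : Set (E d)} (v : H10Vec Ω) : norm10 v = ‖gradVec v‖ := by
  rw [norm10, inner10_eq, real_inner_self_eq_norm_sq, Real.sqrt_sq (norm_nonneg _)]

theorem eq_zero_of_norm10_eq_zero {d : ℕ} {Ω : Set (E d)} (hΩ : IsOpen Ω)
    (hΩb : Bornology.IsBounded Ω) {v : H10Vec Ω} (hv : norm10 v = 0) : v = 0 := by
  rw [norm10_eq, norm_eq_zero, gradVec_eq_zero_iff] at hv
  exact funext fun i => eq_zero_of_pd_eq_zero hΩ hΩb i (hv i)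

theorem divg_sub {d : ℕ} {Ω : Set (E d)} (v w : H10Vec Ω) :
    divg (v - w) = divg v - divg w :=
  Finset.sum_sub_distrib (fun i => pd Ω i (v i)) (fun i => pd Ω i (w i))

theorem divg_smul {d : ℕ} {Ω : Set (E d)} (c : ℝ) (v : H10Vec Ω) :
    divg (c • v) = c • divg v :=
  (Finset.smul_sum (r := c) (f := fun i => pd Ω i (v i)) (s := Finset.univ)).symm

theorem sub_mem_V0hVec {d : ℕ} {Ω : Set (E d)} {𝒯 : Triangulation Ω} {k : ℕ} {v w : H10Vec Ω}
    (hv : v ∈ V0hVec 𝒯 k) (hw : w ∈ V0hVec 𝒯 k) : v - w ∈ V0hVec 𝒯 k :=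
  fun i hi => (Pdisc 𝒯 k).sub_mem (hv i hi) (hw i hi)

/-- The divergence is the trace of the gradient: Cauchy-Schwarz over the diagonal, then the
off-diagonal entries are added. This is the source of the factor `d` in the error bound. -/
theorem norm_sum_diag_sq_le {ι F : Type*} [Fintype ι] [NormedAddCommGroup F]
    (g : PiLp 2 fun _ : ι × ι => F) :
    ‖∑ i, g (i, i)‖ ^ 2 ≤ Fintype.card ι * ‖g‖ ^ 2 := by
  have h1 : ‖∑ i, g (i, i)‖ ^ 2 ≤ (∑ i, ‖g (i, i)‖) ^ 2 :=
    pow_le_pow_left₀ (norm_nonneg _) (norm_sum_le _ _) 2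
  have h2 : (∑ i, ‖g (i, i)‖) ^ 2 ≤ Fintype.card ι * ∑ i, ‖g (i, i)‖ ^ 2 := by
    simpa using sq_sum_le_card_mul_sum_sq (s := Finset.univ) (f := fun i => ‖g (i, i)‖)
  have h3 : ∑ i, ‖g (i, i)‖ ^ 2 ≤ ‖g‖ ^ 2 := by
    rw [PiLp.norm_sq_eq_of_L2, Fintype.sum_prod_type]
    exact Finset.sum_le_sum fun i _ => Finset.single_le_sum
      (f := fun j => ‖g (i, j)‖ ^ 2) (fun j _ => sq_nonneg _) (Finset.mem_univ i)
  exact h1.trans (h2.trans (mul_le_mul_of_nonneg_left h3 (Nat.cast_nonneg _)))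

theorem norm_divg_sq_le {d : ℕ} {Ω : Set (E d)} (v : H10Vec Ω) :
    ‖divg v‖ ^ 2 ≤ d * ‖gradVec v‖ ^ 2 := by
  have h := norm_sum_diag_sq_le (gradVec v)
  rw [Fintype.card_fin] at h
  exact h

/-- Makes the divergence itself admissible as a test function in the mass equation, which forces
`divg u = 0`. -/
theorem divg_mem_L2zmv {d : ℕ} {Ω : Set (E d)} (hΩ : IsOpen Ω) (hΩb : Bornology.IsBounded Ω)
    (v : H10Vec Ω) : divg v ∈ L2zmv Ω := by
  rw [mem_L2zmv_iff hΩb, divg, inner_sum]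
  exact Finset.sum_eq_zero fun i _ => inner_oneL2_pd hΩ hΩb (v i) i

theorem divg_mem_Pdisc {d : ℕ} {Ω : Set (E d)} (hΩ : IsOpen Ω) (𝒯 : Triangulation Ω) {k : ℕ}
    {v : H10Vec Ω} (hv : v ∈ V0hVec 𝒯 k) : divg v ∈ Pdisc 𝒯 (k - 1) :=
  Submodule.sum_mem _ fun i _ => pd_mem_Pdisc hΩ 𝒯 (hv i (Set.mem_univ i)) i

/-! ### Elimination of the pressure -/

theorem IsStokesSolution.divg_eq_zero {d : ℕ} {Ω : Set (E d)} {ν : ℝ} {f : Hm1Vec Ω}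
    {u : H10Vec Ω} {p : L2 Ω} (h : IsStokesSolution ν f u p) (hΩ : IsOpen Ω)
    (hΩb : Bornology.IsBounded Ω) : divg u = 0 :=
  inner_self_eq_zero.1 (h.mass _ (divg_mem_L2zmv hΩ hΩb u))

/-- The momentum balance with the pressure replaced by the potential of the force. -/
theorem IsStokesSolution.momentum_potential {d : ℕ} {Ω : Set (E d)} {ν : ℝ} {f : Hm1Vec Ω}
    {u : H10Vec Ω} {p z : L2 Ω} (h : IsStokesSolution ν f u p) (hz : IsPotential f z)
    (hΩ : IsOpen Ω) (hΩb : Bornology.IsBounded Ω) (v : H10Vec Ω) :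
    ν * inner10 u v - inner ℝ z (divg v) = f v := by
  obtain ⟨w, hw⟩ := hz
  -- The test field `x = ν u - w` is divergence free, so both pressure terms drop and `‖ν ∇u - ∇w‖²
  -- = 0` remains.
  obtain ⟨x, hxG, hxD⟩ : ∃ x : H10Vec Ω, gradVec x = ν • gradVec u - gradVec w ∧
      divg x = ν • divg u - divg w :=
    ⟨ν • u - w, rfl, (divg_sub _ _).trans (congrArg (· - divg w) (divg_smul ν u))⟩
  rw [h.divg_eq_zero hΩ hΩb, hw.divg_eq_zero hΩ hΩb, smul_zero, sub_zero] at hxD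
  have h1 : ν * inner10 u x - inner ℝ p (divg x) = 1 * inner10 w x - inner ℝ z (divg x) :=
    (h.momentum x).trans (hw.momentum x).symm
  rw [hxD, inner_zero_right, inner_zero_right, inner10_eq, inner10_eq, sub_zero, sub_zero,
    one_mul] at h1
  have h3 : ν • gradVec u = gradVec w := by
    rw [← sub_eq_zero, ← hxG, ← inner_self_eq_zero (𝕜 := ℝ)]
    nth_rewrite 1 [hxG]
    rw [inner_sub_left, real_inner_smul_left, h1, sub_self]
  have h4 : ν * inner10 u v = 1 * inner10 w v := by
    rw [inner10_eq, inner10_eq, ← h3, real_inner_smul_left, one_mul]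
  exact (congrArg (· - inner ℝ z (divg v)) h4).trans (hw.momentum v)

/-! ### The two projections -/

theorem inner_projDG {d : ℕ} {Ω : Set (E d)} (𝒯 : Triangulation Ω) (k : ℕ) (z : L2 Ω)
    {q : L2 Ω} (hq : q ∈ Pdisc 𝒯 (k - 1)) : inner ℝ (projDG 𝒯 k z) q = inner ℝ z q := by
  have := Submodule.starProjection_inner_eq_zero (K := Pdisc 𝒯 (k - 1)) z q hq
  rw [inner_sub_left] at this
  rw [projDG]
  linarith

/-- Constants are broken polynomials, so the projection preserves the mean. -/
theorem projDG_mem_Qh {d : ℕ} {Ω : Set (E d)} (hΩb : Bornology.IsBounded Ω)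
    (𝒯 : Triangulation Ω) (k : ℕ) {z : L2 Ω} (hz : z ∈ L2zmv Ω) :
    projDG 𝒯 k z ∈ Qh 𝒯 (k - 1) := by
  refine ⟨Submodule.starProjection_apply_mem _ _, ?_⟩
  rw [mem_L2zmv_iff hΩb] at hz ⊢
  rw [real_inner_comm, inner_projDG 𝒯 k z (oneL2_mem_Pdisc hΩb 𝒯 _), real_inner_comm, hz]

theorem Qh_combination {d : ℕ} {Ω : Set (E d)} (hΩb : Bornology.IsBounded Ω)
    {𝒯 : Triangulation Ω} {k : ℕ} {q r : L2 Ω} (c : ℝ) (hq : q ∈ Qh 𝒯 k) (hr : r ∈ Qh 𝒯 k) :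
    c • q + r ∈ Qh 𝒯 k := by
  refine ⟨Submodule.add_mem _ (Submodule.smul_mem _ c hq.1) hr.1, ?_⟩
  have h1 := (mem_L2zmv_iff hΩb q).1 hq.2
  have h2 := (mem_L2zmv_iff hΩb r).1 hr.2
  rw [mem_L2zmv_iff hΩb, inner_add_right, inner_smul_right, h1, h2, mul_zero, add_zero]

theorem projCG_mem {d : ℕ} {Ω : Set (E d)} (𝒯 : Triangulation Ω) (k : ℕ) (w : Fin d → L2 Ω) :
    projCG 𝒯 k w ∈ V0hVec 𝒯 k := (exists_projCG 𝒯 k w).choose_spec.1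

theorem eq_zero_of_sum_inner_self_eq_zero {ι F : Type*} [Fintype ι] [NormedAddCommGroup F]
    [InnerProductSpace ℝ F] {a : ι → F} (h : ∑ i, inner ℝ (a i) (a i) = 0) (i : ι) : a i = 0 :=
  inner_self_eq_zero.1 ((Finset.sum_eq_zero_iff_of_nonneg fun _ _ => real_inner_self_nonneg).1 h i
    (Finset.mem_univ i))

/-- The projection error is discrete and `L²`-orthogonal to discrete fields, hence to itself; its
gradient then vanishes with it. -/
theorem norm10_sub_projCG_eq_zero {d : ℕ} {Ω : Set (E d)} (hΩ : IsOpen Ω)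
    (𝒯 : Triangulation Ω) {k : ℕ} {u : H10Vec Ω} (hu : u ∈ V0hVec 𝒯 k) :
    norm10 (u - projCG 𝒯 k (fun i => val Ω (u i))) = 0 := by
  obtain ⟨e, he⟩ : ∃ e, e = u - projCG 𝒯 k (fun i => val Ω (u i)) := ⟨_, rfl⟩
  have hmem : e ∈ V0hVec 𝒯 k := by
    rw [he]
    exact sub_mem_V0hVec hu (projCG_mem 𝒯 k _)
  have h : ∑ i, inner ℝ (val Ω (e i)) (val Ω (e i)) = 0 := by
    have := (exists_projCG 𝒯 k fun i => val Ω (u i)).choose_spec.2 e hmem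
    subst he
    exact this
  have h0 := eq_zero_of_sum_inner_self_eq_zero (a := fun i => val Ω (e i)) h
  rw [← he, norm10_eq, norm_eq_zero, gradVec_eq_zero_iff]
  exact fun i => pd_eq_zero_of_val_eq_zero hΩ (h0 i)

theorem IsPolyVec.mem_V0hVec {d : ℕ} {Ω : Set (E d)} (𝒯 : Triangulation Ω) {k : ℕ}
    {u : H10Vec Ω} (hu : IsPolyVec k u) : u ∈ V0hVec 𝒯 k := by
  intro i _ s _
  obtain ⟨P, hP, h⟩ := hu i
  exact ⟨P, hP, h.mono fun x hx _ => hx⟩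

/-! ### Error estimate -/

/-- The energy estimate behind the error bound: `e` is the error of the gradient, `r` the one of
the pressure, `Dh` the discrete divergence, and `g`, `D` are the gradient and the divergence of the
approximation error. -/
theorem sqrt_norm_sq_add_le {G H : Type*} [NormedAddCommGroup G] [InnerProductSpace ℝ G]
    [NormedAddCommGroup H] [InnerProductSpace ℝ H] {ν lam c : ℝ} (hν : 0 < ν) (hlam : 0 < lam)
    (hc : 0 ≤ c) {e g : G} {r Dh D : H}
    (hmass : lam * inner ℝ r Dh + ν⁻¹ * ‖r‖ ^ 2 = 0)
    (hmom : ν * inner ℝ e (e + g) = inner ℝ r (Dh + D)) (hD : ‖D‖ ^ 2 ≤ c * ‖g‖ ^ 2) :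
    Real.sqrt (‖e‖ ^ 2 + ((Real.sqrt lam * ν) ^ 2)⁻¹ * ‖r‖ ^ 2)
      ≤ Real.sqrt (1 + c * lam) * ‖g‖ := by
  rw [inner_add_right, real_inner_self_eq_norm_sq, inner_add_right] at hmom
  have hc1 := neg_le_of_abs_le (abs_real_inner_le_norm e g)
  have hc2 := real_inner_le_norm r D
  have ha := norm_nonneg g
  have hr0 := norm_nonneg r
  generalize ‖e‖ = e' at *
  generalize ‖g‖ = a at *
  generalize ‖D‖ = D' at *
  generalize ‖r‖ = ρ at *
  obtain ⟨t, ht, rfl⟩ : ∃ t : ℝ, 0 < t ∧ t ^ 2 = lam :=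
    ⟨Real.sqrt lam, Real.sqrt_pos.2 hlam, Real.sq_sqrt hlam.le⟩
  rw [Real.sqrt_sq ht.le]
  -- Rescaled so that the weighted pressure term is exactly `s ^ 2`.
  obtain ⟨s, rfl⟩ : ∃ s, ρ = t * ν * s := ⟨ρ / (t * ν), by field_simp⟩
  have hs : 0 ≤ s := nonneg_of_mul_nonneg_right hr0 (by positivity)
  have e1 : ((t * ν) ^ 2)⁻¹ * (t * ν * s) ^ 2 = s ^ 2 := by field_simp
  rw [e1]
  have e2 : inner ℝ r (Dh) = -(ν * s ^ 2) := by
    have : t ^ 2 * (inner ℝ r (Dh) + ν * s ^ 2) = 0 := by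
      rw [← hmass]; field_simp
    have := (mul_eq_zero.1 this).resolve_left (by positivity)
    linarith
  -- The energy identity divided by `ν`; the mass equation puts `s ^ 2` on the left.
  have key : e' ^ 2 + s ^ 2 ≤ e' * a + s * (t * D') := by
    refine le_of_mul_le_mul_left ?_ hν
    rw [e2] at hmom
    have := mul_le_mul_of_nonneg_left hc1 hν.le
    linarith
  have hN : 0 ≤ e' ^ 2 + s ^ 2 := by positivity
  -- Cauchy-Schwarz in the plane for `(e', s)` and `(a, t * D')`, then `hD`.
  have cs : (e' * a + s * (t * D')) ^ 2 ≤ (e' ^ 2 + s ^ 2) * ((1 + c * t ^ 2) * a ^ 2) := by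
    have h1 : (e' * a + s * (t * D')) ^ 2 ≤ (e' ^ 2 + s ^ 2) * (a ^ 2 + (t * D') ^ 2) := by
      linarith [sq_nonneg (e' * (t * D') - s * a)]
    refine h1.trans (mul_le_mul_of_nonneg_left ?_ hN)
    have := mul_le_mul_of_nonneg_left hD (sq_nonneg t)
    linarith
  have fin : e' ^ 2 + s ^ 2 ≤ (1 + c * t ^ 2) * a ^ 2 := by
    rcases hN.eq_or_lt with h0 | h0
    · rw [← h0]; positivity
    · refine le_of_mul_le_mul_left ?_ h0
      rw [← sq]
      exact (pow_le_pow_left₀ hN key 2).trans cs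
  calc Real.sqrt (e' ^ 2 + s ^ 2) ≤ Real.sqrt ((1 + c * t ^ 2) * a ^ 2) := Real.sqrt_le_sqrt fin
    _ = _ := by rw [Real.sqrt_mul (by positivity), Real.sqrt_sq ha]

/-- The error of the discrete solution is bounded by the distance of `u` from any discrete field. -/
theorem IsDiscreteSolution.normX_sub_le {d : ℕ} {Ω : Set (E d)} (hΩ : IsOpen Ω)
    (hΩb : Bornology.IsBounded Ω) {𝒯 : Triangulation Ω} {k : ℕ} {ν lam : ℝ} (hν : 0 < ν)
    (hlam : 0 < lam) {f : Hm1Vec Ω} {u : H10Vec Ω} {p : L2 Ω} (hup : IsStokesSolution ν f u p)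
    {z : L2 Ω} (hz : IsPotential f z) {uh : H10Vec Ω} {ph : L2 Ω}
    (h : IsDiscreteSolution 𝒯 k ν lam f z uh ph) {π : H10Vec Ω} (hπ : π ∈ V0hVec 𝒯 k) :
    normX (Real.sqrt lam * ν) (uh - u) (ph - projDG 𝒯 k z)
      ≤ Real.sqrt (1 + d * lam) * norm10 (u - π) := by
  have hzm : z ∈ L2zmv Ω := hz.choose_spec.zero_mean
  obtain ⟨r, hr⟩ : ∃ r, r = ph - projDG 𝒯 k z := ⟨_, rfl⟩
  have hrQ : r ∈ Qh 𝒯 (k - 1) := by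
    have := Qh_combination hΩb (-1) (projDG_mem_Qh hΩb 𝒯 k hzm) h.pressure_mem
    rwa [neg_one_smul, neg_add_eq_sub, ← hr] at this
  have hmass : lam * inner ℝ r (divg uh) + ν⁻¹ * ‖r‖ ^ 2 = 0 := by
    have h1 := h.mass r hrQ
    have h2 : ‖r‖ ^ 2 = inner ℝ ph r - inner ℝ z r := by
      rw [← inner_projDG 𝒯 k z hrQ.1, ← inner_sub_left, ← hr, real_inner_self_eq_norm_sq]
    rw [h2]
    linarith
  obtain ⟨e, he, heG⟩ : ∃ e, e = uh - u ∧ gradVec e = gradVec uh - gradVec u :=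
    ⟨_, rfl, gradVec_sub _ _⟩
  obtain ⟨w, hw, hwG, hwD⟩ : ∃ w, w = u - π ∧ gradVec w = gradVec u - gradVec π ∧
      divg w = divg u - divg π :=
    ⟨_, rfl, gradVec_sub _ _, divg_sub _ _⟩
  obtain ⟨v, hv, hvG, hvD⟩ : ∃ v ∈ V0hVec 𝒯 k, gradVec v = gradVec uh - gradVec π ∧
      divg v = divg uh - divg π :=
    ⟨_, sub_mem_V0hVec h.velocity_mem hπ, gradVec_sub _ _, divg_sub _ _⟩
  -- Here `e + w = v = uh - π` is discrete, so it may be tested with; `divg u = 0` gives `divg v =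
  -- divg uh + divg w`.
  have hmom : ν * inner ℝ (gradVec e) (gradVec e + gradVec w) =
      inner ℝ r (divg uh + divg w) := by
    have hG : gradVec e + gradVec w = gradVec v := by
      rw [heG, hwG, hvG, sub_add_sub_cancel]
    have hD : divg uh + divg w = divg v := by
      rw [hwD, hvD, hup.divg_eq_zero hΩ hΩb]; abel
    have h1 : ν * lam * inner10 uh v - lam * inner ℝ ph (divg v) =
        lam * (ν * inner10 u v - inner ℝ z (divg v)) :=
      (h.momentum v hv).trans
        (congrArg (lam * ·) (hup.momentum_potential hz hΩ hΩb v).symm)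
    rw [hG, hD, heG, hr, inner_sub_left, inner_sub_left,
      inner_projDG 𝒯 k z (divg_mem_Pdisc hΩ 𝒯 hv)]
    rw [inner10_eq, inner10_eq] at h1
    exact mul_left_cancel₀ hlam.ne' (by linear_combination h1)
  rw [← he, ← hw, ← hr, normX, norm10_eq, norm10_eq]
  exact sqrt_norm_sq_add_le hν hlam (Nat.cast_nonneg d) hmass hmom (norm_divg_sq_le w)

theorem eq_zero_of_normX_le_zero {d : ℕ} {Ω : Set (E d)} (hΩ : IsOpen Ω)
    (hΩb : Bornology.IsBounded Ω) {μ : ℝ} (hμ : 0 < μ) {v : H10Vec Ω} {q : L2 Ω}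
    (h : normX μ v q ≤ 0) : v = 0 ∧ q = 0 := by
  rw [normX, Real.sqrt_le_iff] at h
  have h1 := sq_nonneg (norm10 v)
  have h2 : 0 ≤ (μ ^ 2)⁻¹ * ‖q‖ ^ 2 := by positivity
  have h3 : norm10 v ^ 2 = 0 := by linarith [h.2]
  have h4 : (μ ^ 2)⁻¹ * ‖q‖ ^ 2 = 0 := by linarith [h.2]
  refine ⟨eq_zero_of_norm10_eq_zero hΩ hΩb (pow_eq_zero_iff two_ne_zero |>.1 h3), ?_⟩
  have := (mul_eq_zero.1 h4).resolve_left (by positivity)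
  simpa using this

end StokesFE

theorem mainTheorem6 (d : ℕ) (hd : d = 2 ∨ d = 3)
    (Ω : Set (EuclideanSpace ℝ (Fin d)))
    (hΩo : IsOpen Ω) (hΩc : IsConnected Ω) (hΩb : Bornology.IsBounded Ω)
    (𝒯 : Triangulation Ω) (k : ℕ) (hk : 1 ≤ k)
    (ν lam : ℝ) (hν : 0 < ν) (hlam : 0 < lam)
    (f : Hm1Vec Ω)
    (u : H10Vec Ω) (p : L2 Ω) (hup : IsStokesSolution ν f u p)
    (zf : L2 Ω) (hzf : IsPotential f zf)
    (uh : H10Vec Ω) (ph : L2 Ω) (huph : IsDiscreteSolution 𝒯 k ν lam f zf uh ph) :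
    normX (Real.sqrt lam * ν) (uh - u) (ph - projDG 𝒯 k zf)
        ≤ Real.sqrt (1 + d * lam) * norm10 (u - projCG 𝒯 k (fun i => val Ω (u i))) ∧
      (IsPolyVec k u → uh = u ∧ ph = projDG 𝒯 k zf) := by
  have h := huph.normX_sub_le hΩo hΩb hν hlam hup hzf
    (projCG_mem 𝒯 k fun i => val Ω (u i))
  refine ⟨h, fun hu => ?_⟩
  rw [norm10_sub_projCG_eq_zero hΩo 𝒯 (hu.mem_V0hVec 𝒯), mul_zero] at h
  obtain ⟨h1, h2⟩ := eq_zero_of_normX_le_zero hΩo hΩb (mul_pos (Real.sqrt_pos.2 hlam) hν) h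
  exact ⟨sub_eq_zero.1 h1, sub_eq_zero.1 h2⟩
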